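/- Let $T$ be a nonempty compact topological space, let $a_t\in\mathbb R^n$ and $b_t\in\mathbb R$ depend continuously on $t\in T$, and consider the linear system $\langle a_t,x\rangle\le b_t$ $(t\in T)$. Put $\phi(x)=\max_{t\in T}(\langle a_t,x\rangle-b_t)$, let $S=[\phi\le 0]=\{x\mid \phi(x)\le 0\}$ be its solution set, and $T(x)=\{t\in T\mid \langle a_t,x\rangle-b_t=\phi(x)\}$. Notation. $\operatorname{co}$ is the convex hull, $\operatorname{pos}A=\{0\}\cup\{\lambda x\mid x\in A,\lambda>0\}$, $A^*=\{v\mid\langle v,x\rangle\le 0\ \forall x\in A\}$, $\sigma_A(w)=\sup_{x\in A}\langle x,w\rangle$, $d(0,\emptyset)=+\infty$. For $g:\mathbb R^n\to[-\infty,+\infty]$ finite at $x$: $v\in\hat\partial g(x)$ if $g(y)\ge g(x)+\langle v,y-x\rangle+o(\|y-x\|)$; $v\in\partial g(x)$ if $v=\lim v_k$ with $v_k\in\hat\partial g(x_k)$, $x_k\to x$, $g(x_k)\to g(x)$; $v\in\partial^>g(x)$ if $v=\lim v_k$ with $v_k\in\partial g(x_k)$, $x_k\to x$, $g(x_k)\to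 g(x)$, $g(x_k)>g(x)$. The error bound modulus $\operatorname{ebm}(g,x)\in[0,+\infty]$ is the supremum of all $\tau>0$ such that $\tau\, d(y,[g\le 0])\le\max\{g(y),0\}$ for all $y$ in some neighbourhood of $x$ (and $0$ if there is no such $\tau$). For $x\in S$ consider (R) there is a neighbourhood $V$ of $x$ with $\{y\mid\langle a_t,y\rangle\le b_t\ \forall t\in T\}\cap V=(x+\{w\mid\langle a_t,w\rangle\le 0\ \forall t\in T(x)\})\cap V$; (P) $(\operatorname{pos}\operatorname{co}\{a_t\mid t\in T(x)\})^*=\operatorname{pos}(S-x)$; (M) $d(0,\partial^>\phi(x))=\operatorname{ebm}(\phi,x)=d(0,\partial^>\sigma_{\partial\phi(x)}(0))=d\bigl(0,\bigcup_{T'\in\mathcal T(x)}\operatorname{co}\{a_t\mid t\in T'\}\bigr)$, where $\mathcal T(x)$ consists of all $T'\subset T(x)$ for which there is $w\in\mathbb R^n$ with $\langle a_t,w\rangle=1$ for all $t\in T'$ and $\langle a_t,w\rangle<1$ for all $t\in T(x)\setminus T'$. Then, both for $X=S$ and for $X=\operatorname{bd}S$: (R) holds at every $x\in X$ if and only if (P)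 holds at every $x\in X$ (for $X = \operatorname{bd} S$: the system is locally polyhedral); and if either of these conditions is satisfied, then (M) holds at every $x\in X$. Moreover, if $T$ is finite, then (P), and hence (M), holds at every $x\in\operatorname{bd}S$. -/

import Mathlib

open Filter Topology
open scoped ENNReal NNReal

noncomputable section

namespace ErrBound

/-! ### Variational analysis in Euclidean space -/

/-- The positive hull `{0} ∪ {c x | x ∈ A, c > 0}`. -/
def posHull {n : ℕ} (A : Set (EuclideanSpace ℝ (Fin n))) : Set (EuclideanSpace ℝ (Fin n)) :=
  {0} ∪ {y | ∃ c : ℝ, 0 < c ∧ ∃ x ∈ A, y = c • x}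

/-- The polar cone `{v | ⟨v, x⟩ ≤ 0 for all x ∈ A}`. -/
def polarCone {n : ℕ} (A : Set (EuclideanSpace ℝ (Fin n))) : Set (EuclideanSpace ℝ (Fin n)) :=
  {v | ∀ x ∈ A, inner ℝ v x ≤ 0}

/-- The support function `w ↦ sup_{x ∈ A} ⟨x, w⟩`, with values in the extended reals. -/
def supportFun {n : ℕ} (A : Set (EuclideanSpace ℝ (Fin n))) (w : EuclideanSpace ℝ (Fin n)) :
    EReal :=
  ⨆ x ∈ A, ((inner ℝ x w : ℝ) : EReal)

/-- Regular subgradients of `g` at a point `x` where `g` is finite: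
`g y ≥ g x + ⟨v, y - x⟩ + o(‖y - x‖)` as `y → x`. -/
def regularSubdiff {n : ℕ} (g : EuclideanSpace ℝ (Fin n) → EReal)
    (x : EuclideanSpace ℝ (Fin n)) : Set (EuclideanSpace ℝ (Fin n)) :=
  {v | g x ≠ ⊤ ∧ g x ≠ ⊥ ∧ ∀ ε : ℝ, 0 < ε → ∀ᶠ y in 𝓝 x,
    g x + ((inner ℝ v (y - x) - ε * ‖y - x‖ : ℝ) : EReal) ≤ g y}

/-- General (limiting) subgradients of `g` at a point `x` where `g` is finite. -/
def subdiff {n : ℕ} (g : EuclideanSpace ℝ (Fin n) → EReal)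
    (x : EuclideanSpace ℝ (Fin n)) : Set (EuclideanSpace ℝ (Fin n)) :=
  {v | g x ≠ ⊤ ∧ g x ≠ ⊥ ∧ ∃ u p : ℕ → EuclideanSpace ℝ (Fin n),
    Tendsto u atTop (𝓝 x) ∧ Tendsto (fun k => g (u k)) atTop (𝓝 (g x)) ∧
    (∀ k, p k ∈ regularSubdiff g (u k)) ∧ Tendsto p atTop (𝓝 v)}

/-- The outer limiting subdifferential: limits of subgradients of `g` at points `u k → x` with
`g (u k) → g x` and `g (u k) > g x`. -/
def outerSubdiff {n : ℕ} (g : EuclideanSpace ℝ (Fin n) → EReal)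
    (x : EuclideanSpace ℝ (Fin n)) : Set (EuclideanSpace ℝ (Fin n)) :=
  {v | g x ≠ ⊤ ∧ g x ≠ ⊥ ∧ ∃ u p : ℕ → EuclideanSpace ℝ (Fin n),
    Tendsto u atTop (𝓝 x) ∧ Tendsto (fun k => g (u k)) atTop (𝓝 (g x)) ∧
    (∀ k, g x < g (u k)) ∧ (∀ k, p k ∈ subdiff g (u k)) ∧ Tendsto p atTop (𝓝 v)}

/-- The local error bound modulus of `g` at `x`: the supremum in `[0, ∞]` of all `τ > 0` such that
`τ d(y, [g ≤ 0]) ≤ max (g y) 0` for all `y` in a neighbourhood of `x`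
(it is `0` if there is no such `τ`). -/
def errBoundModulus {n : ℕ} (g : EuclideanSpace ℝ (Fin n) → EReal)
    (x : EuclideanSpace ℝ (Fin n)) : ℝ≥0∞ :=
  ⨆ (τ : ℝ≥0) (_ : 0 < τ ∧ ∀ᶠ y in 𝓝 x,
    (τ : ℝ≥0∞) * Metric.infEDist y {z | g z ≤ 0} ≤ (g y).toENNReal), (τ : ℝ≥0∞)

/-! ### The linear system `⟨a t, x⟩ ≤ b t` for all `t` -/

/-- `φ x = max_t (⟨a t, x⟩ - b t)`. -/
def maxFun {n : ℕ} {T : Type*} (a : T → EuclideanSpace ℝ (Fin n)) (b : T → ℝ)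
    (x : EuclideanSpace ℝ (Fin n)) : ℝ :=
  ⨆ t, (inner ℝ (a t) x - b t)

/-- Over a nonempty compact index space with continuous data the supremum is a maximum. -/
theorem isGreatest_maxFun {n : ℕ} {T : Type*} [TopologicalSpace T] [CompactSpace T] [Nonempty T]
    (a : T → EuclideanSpace ℝ (Fin n)) (b : T → ℝ) (ha : Continuous a) (hb : Continuous b)
    (x : EuclideanSpace ℝ (Fin n)) :
    IsGreatest (Set.range fun t => inner ℝ (a t) x - b t) (maxFun a b x) := by
  have hc : Continuous fun t => inner ℝ (a t) x - b t := by fun_prop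
  exact (isCompact_range hc).isGreatest_sSup (Set.range_nonempty _)

/-- The solution set `[φ ≤ 0]`. -/
def solSet {n : ℕ} {T : Type*} (a : T → EuclideanSpace ℝ (Fin n)) (b : T → ℝ) :
    Set (EuclideanSpace ℝ (Fin n)) :=
  {y | maxFun a b y ≤ 0}

/-- The solution set of the linear system is the level set `[φ ≤ 0]`. -/
theorem mem_solSet_iff {n : ℕ} {T : Type*} [TopologicalSpace T] [CompactSpace T] [Nonempty T]
    (a : T → EuclideanSpace ℝ (Fin n)) (b : T → ℝ) (ha : Continuous a) (hb : Continuous b)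
    (x : EuclideanSpace ℝ (Fin n)) :
    x ∈ solSet a b ↔ ∀ t, inner ℝ (a t) x ≤ b t := by
  have h := isGreatest_maxFun a b ha hb x
  constructor
  · intro hx t
    have h1 : inner ℝ (a t) x - b t ≤ maxFun a b x := h.2 ⟨t, rfl⟩
    have h2 : maxFun a b x ≤ 0 := hx
    linarith
  · intro hx
    obtain ⟨t, ht⟩ := h.1
    have ht' : inner ℝ (a t) x - b t = maxFun a b x := ht
    have h1 := hx t
    show maxFun a b x ≤ 0
    linarith

/-- The active index set `T(x) = {t | ⟨a t, x⟩ - b t = φ x}`. -/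
def activeSet {n : ℕ} {T : Type*} (a : T → EuclideanSpace ℝ (Fin n)) (b : T → ℝ)
    (x : EuclideanSpace ℝ (Fin n)) : Set T :=
  {t | inner ℝ (a t) x - b t = maxFun a b x}

/-- The regularity condition at `x`: near `x`, the solution set coincides with the translate to `x`
of the cone `{w | ⟨a t, w⟩ ≤ 0 for all t ∈ T(x)}`. -/
def RegularAt {n : ℕ} {T : Type*} (a : T → EuclideanSpace ℝ (Fin n)) (b : T → ℝ)
    (x : EuclideanSpace ℝ (Fin n)) : Prop :=
  ∃ V ∈ 𝓝 x, {y | ∀ t, inner ℝ (a t) y ≤ b t} ∩ V =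
    {y | ∃ w, (∀ t ∈ activeSet a b x, inner ℝ (a t) w ≤ 0) ∧ y = x + w} ∩ V

/-- The locally polyhedral condition at `x`: `(pos co {a t | t ∈ T(x)})^* = pos ([φ ≤ 0] - x)`. -/
def LocallyPolyhedralAt {n : ℕ} {T : Type*} (a : T → EuclideanSpace ℝ (Fin n)) (b : T → ℝ)
    (x : EuclideanSpace ℝ (Fin n)) : Prop :=
  polarCone (posHull (convexHull ℝ (a '' activeSet a b x))) =
    posHull ((fun y => y - x) '' solSet a b)

/-- The collection of all `T' ⊆ T(x)` for which some `w` satisfies `⟨a t, w⟩ = 1` for `t ∈ T'` and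
`⟨a t, w⟩ < 1` for `t ∈ T(x) \ T'`. -/
def activeFaces {n : ℕ} {T : Type*} (a : T → EuclideanSpace ℝ (Fin n)) (b : T → ℝ)
    (x : EuclideanSpace ℝ (Fin n)) : Set (Set T) :=
  {T' | T' ⊆ activeSet a b x ∧ ∃ w : EuclideanSpace ℝ (Fin n),
    (∀ t ∈ T', inner ℝ (a t) w = 1) ∧ ∀ t ∈ activeSet a b x \ T', inner ℝ (a t) w < 1}

/-- The modulus formulas at `x`:
`d(0, ∂^> φ(x)) = ebm(φ, x) = d(0, ∂^> σ_{∂φ(x)}(0)) = d(0, ⋃_{T'} co {a t | t ∈ T'})`,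
all in `[0, ∞]`, with `d(0, ∅) = ∞`. -/
def ModulusFormulas {n : ℕ} {T : Type*} (a : T → EuclideanSpace ℝ (Fin n)) (b : T → ℝ)
    (x : EuclideanSpace ℝ (Fin n)) : Prop :=
  let φ : EuclideanSpace ℝ (Fin n) → EReal := fun y => (maxFun a b y : EReal)
  Metric.infEDist 0 (outerSubdiff φ x) = errBoundModulus φ x ∧
  errBoundModulus φ x = Metric.infEDist 0 (outerSubdiff (supportFun (subdiff φ x)) 0) ∧
  Metric.infEDist 0 (outerSubdiff (supportFun (subdiff φ x)) 0) =
    Metric.infEDist 0 (⋃ T' ∈ activeFaces a b x, convexHull ℝ (a '' T'))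

end ErrBound

end

noncomputable section

namespace ErrBound

/-! ### Elementary properties of the maximum function -/

section MaxFun

/-! Since `T` is compact, `φ` is continuous and convex, and Hahn–Banach with a directional growth
estimate identifies its subdifferential at `x` as the closed convex hull of the active coefficients.

Where `φ(x) = 0`, the identity `d(0, ∂^>φ(x)) = ebm(φ, x)` holds without any polyhedrality
(`infEDist_outerSubdiff_maxFun`). A failing constant produces small subgradients near `x` by
minimising a penalised residual; conversely, the subgradient inequality at the projection onto `S`
bounds subgradients below. The support function `σ` of `∂φ(x)` is the maximum function of the
homogeneous active system, so the same identity applies to it at `0`, and positive homogeneity gives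
the face formula. Only `ebm(φ, x) = ebm(σ, 0)` needs (R): near `x` the distance to `S` is then the
distance to the linearised cone (`RegularAt.hasErrBound_iff`).

(R) implies (P) pointwise by scaling. For the converse, (P) makes cones of feasible directions
closed, being polars, and a convex set whose cones are all closed is locally conical
(`exists_forall_mem_of_isClosed_feasibleCone`, by induction on the codimension of the lineality
space).

Boundary points satisfy `φ = 0`. If (R) holds on all of `S` and `φ(x) < 0` somewhere, then `φ` is
constant and all four quantities are infinite. -/

theorem isClosed_activeSet {n : ℕ} {T : Type*} [TopologicalSpace T]
    {a : T → EuclideanSpace ℝ (Fin n)} {b : T → ℝ} (ha : Continuous a) (hb : Continuous b)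
    (x : EuclideanSpace ℝ (Fin n)) : IsClosed (activeSet a b x) :=
  isClosed_eq (by fun_prop) continuous_const

variable {n : ℕ} {T : Type*} [TopologicalSpace T] [CompactSpace T] [Nonempty T]
  {a : T → EuclideanSpace ℝ (Fin n)} {b : T → ℝ}

theorem le_maxFun (ha : Continuous a) (hb : Continuous b) (x : EuclideanSpace ℝ (Fin n)) (t : T) :
    inner ℝ (a t) x - b t ≤ maxFun a b x :=
  (isGreatest_maxFun a b ha hb x).2 ⟨t, rfl⟩

theorem exists_mem_activeSet (ha : Continuous a) (hb : Continuous b)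
    (x : EuclideanSpace ℝ (Fin n)) : ∃ t, t ∈ activeSet a b x :=
  (isGreatest_maxFun a b ha hb x).1

theorem lt_maxFun_of_notMem_activeSet (ha : Continuous a) (hb : Continuous b)
    {x : EuclideanSpace ℝ (Fin n)} {t : T} (ht : t ∉ activeSet a b x) :
    inner ℝ (a t) x - b t < maxFun a b x :=
  lt_of_le_of_ne (le_maxFun ha hb x t) ht

theorem maxFun_le_iff (ha : Continuous a) (hb : Continuous b) {x : EuclideanSpace ℝ (Fin n)}
    {c : ℝ} : maxFun a b x ≤ c ↔ ∀ t, inner ℝ (a t) x - b t ≤ c := by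
  refine ⟨fun h t => (le_maxFun ha hb x t).trans h, fun h => ?_⟩
  obtain ⟨t, ht⟩ := exists_mem_activeSet ha hb x
  exact ht ▸ h t

theorem maxFun_lt_iff (ha : Continuous a) (hb : Continuous b) {x : EuclideanSpace ℝ (Fin n)}
    {c : ℝ} : maxFun a b x < c ↔ ∀ t, inner ℝ (a t) x - b t < c := by
  refine ⟨fun h t => (le_maxFun ha hb x t).trans_lt h, fun h => ?_⟩
  obtain ⟨t, ht⟩ := exists_mem_activeSet ha hb x
  exact ht ▸ h t

/-- One active index gives lower semicontinuity; upper semicontinuity is where compactness of `T`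
enters. -/
theorem continuous_maxFun (ha : Continuous a) (hb : Continuous b) :
    Continuous (maxFun a b) := by
  refine continuous_iff_continuousAt.2 fun x => tendsto_order.2 ⟨fun c hc => ?_, fun c hc => ?_⟩
  · obtain ⟨t, ht⟩ := exists_mem_activeSet ha hb x
    have hc' : c < inner ℝ (a t) x - b t := hc.trans_eq ht.symm
    have h : Continuous fun y => inner ℝ (a t) y - b t := by fun_prop
    filter_upwards [h.continuousAt.eventually (lt_mem_nhds hc')] with y hy
    exact hy.trans_le (le_maxFun ha hb y t)
  · have h : Continuous fun z : EuclideanSpace ℝ (Fin n) × T => inner ℝ (a z.2) z.1 - b z.2 := by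
      fun_prop
    have := isCompact_univ.eventually_forall_of_forall_eventually (x₀ := x) (K := (Set.univ : Set T))
      (P := fun y t => inner ℝ (a t) y - b t < c) fun t _ =>
        h.continuousAt.eventually (gt_mem_nhds ((le_maxFun ha hb x t).trans_lt hc))
    filter_upwards [this] with y hy
    exact (maxFun_lt_iff ha hb).2 fun t => hy t trivial

theorem isClosed_solSet (ha : Continuous a) (hb : Continuous b) : IsClosed (solSet a b) :=
  isClosed_le (continuous_maxFun ha hb) continuous_const

theorem convex_solSet (ha : Continuous a) (hb : Continuous b) : Convex ℝ (solSet a b) := by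
  intro x hx y hy r s hr hs hrs
  rw [mem_solSet_iff a b ha hb] at *
  intro t
  rw [inner_add_right, inner_smul_right, inner_smul_right]
  obtain rfl : s = 1 - r := by linarith
  nlinarith [mul_le_mul_of_nonneg_left (hx t) hr, mul_le_mul_of_nonneg_left (hy t) hs]

/-- An upper estimate of the directional derivative of a maximum function. -/
theorem eventually_maxFun_add_smul_lt (ha : Continuous a) (hb : Continuous b)
    {x d : EuclideanSpace ℝ (Fin n)} {c : ℝ}
    (h : ∀ t ∈ activeSet a b x, inner ℝ (a t) d < c) :
    ∀ᶠ s in 𝓝[>] (0 : ℝ), maxFun a b (x + s • d) < maxFun a b x + s * c := by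
  -- Indices of growth rate at least `c` are inactive and form a compact set, so they stay below the
  -- bound uniformly for small `s`; all others grow too slowly.
  have hK : IsCompact {t | c ≤ inner ℝ (a t) d} :=
    (isClosed_le continuous_const (by fun_prop)).isCompact
  have hg : Continuous fun z : ℝ × T =>
      inner ℝ (a z.2) (x + z.1 • d) - b z.2 - (maxFun a b x + z.1 * c) := by fun_prop
  have := hK.eventually_forall_of_forall_eventually (x₀ := (0 : ℝ))
    (P := fun s t => inner ℝ (a t) (x + s • d) - b t - (maxFun a b x + s * c) < 0) fun t ht => by
      refine hg.continuousAt.eventually (gt_mem_nhds ?_)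
      have h1 : t ∉ activeSet a b x := fun h' => (h t h').not_ge ht
      have := lt_maxFun_of_notMem_activeSet ha hb h1
      simpa using this
  filter_upwards [nhdsWithin_le_nhds this, self_mem_nhdsWithin] with s hs hs0
  have hs0 : 0 < s := hs0
  refine (maxFun_lt_iff ha hb).2 fun t => ?_
  by_cases ht : c ≤ inner ℝ (a t) d
  · linarith [hs t ht]
  · have h1 := le_maxFun ha hb x t
    have h2 := mul_lt_mul_of_pos_left (not_le.1 ht) hs0
    rw [inner_add_right, inner_smul_right]
    linarith

/-! ### Subdifferentials of the maximum function -/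

theorem add_inner_le_maxFun (ha : Continuous a) (hb : Continuous b)
    {x p : EuclideanSpace ℝ (Fin n)} (hp : p ∈ closure (convexHull ℝ (a '' activeSet a b x)))
    (y : EuclideanSpace ℝ (Fin n)) : maxFun a b x + inner ℝ p (y - x) ≤ maxFun a b y := by
  have hc : Convex ℝ {p : EuclideanSpace ℝ (Fin n) |
      maxFun a b x + inner ℝ p (y - x) ≤ maxFun a b y} := by
    intro p hp q hq r s hr hs hrs
    simp only [Set.mem_ofPred_eq, inner_add_left, real_inner_smul_left] at *
    obtain rfl : s = 1 - r := by linarith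
    nlinarith [mul_le_mul_of_nonneg_left hp hr, mul_le_mul_of_nonneg_left hq hs]
  refine closure_minimal (convexHull_min ?_ hc) (isClosed_le (by fun_prop) continuous_const) hp
  rintro _ ⟨t, ht, rfl⟩
  have h1 : inner ℝ (a t) x - b t = maxFun a b x := ht
  have h2 := le_maxFun ha hb y t
  simp only [Set.mem_ofPred_eq, inner_sub_right]
  linarith

/-- A vector outside the hull of the active coefficients is separated from it, and the maximum
function grows strictly slower than the vector in the separating direction. -/
theorem exists_direction_of_notMem (ha : Continuous a) (hb : Continuous b)
    {x p : EuclideanSpace ℝ (Fin n)} (hp : p ∉ closure (convexHull ℝ (a '' activeSet a b x))) :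
    ∃ (d : EuclideanSpace ℝ (Fin n)) (c : ℝ), c < inner ℝ p d ∧
      ∀ᶠ s in 𝓝[>] (0 : ℝ), maxFun a b (x + s • d) < maxFun a b x + s * c := by
  obtain ⟨f, c, h1, h2⟩ := geometric_hahn_banach_closed_point (convex_convexHull ℝ _).closure
    isClosed_closure hp
  have hf : ∀ q, inner ℝ q ((InnerProductSpace.toDual ℝ _).symm f) = f q := fun q => by
    rw [real_inner_comm, InnerProductSpace.toDual_symm_apply]
  refine ⟨(InnerProductSpace.toDual ℝ _).symm f, c, by rwa [hf], ?_⟩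
  refine eventually_maxFun_add_smul_lt ha hb fun t ht => ?_
  rw [hf]
  exact h1 _ (subset_closure <| subset_convexHull ℝ _ ⟨t, ht, rfl⟩)

/-- The global inequality on the right survives limits in `x` and `p`, which is why limiting
subgradients add nothing to regular ones. -/
theorem mem_closure_convexHull_active_iff (ha : Continuous a) (hb : Continuous b)
    {x p : EuclideanSpace ℝ (Fin n)} : p ∈ closure (convexHull ℝ (a '' activeSet a b x)) ↔
      ∀ y, maxFun a b x + inner ℝ p (y - x) ≤ maxFun a b y := by
  refine ⟨fun hp => add_inner_le_maxFun ha hb hp, fun h => ?_⟩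
  by_contra hp
  obtain ⟨d, c, hc, hs⟩ := exists_direction_of_notMem ha hb hp
  obtain ⟨s, hs, hs0⟩ := (hs.and self_mem_nhdsWithin).exists
  have hs0 : 0 < s := hs0
  have := h (x + s • d)
  rw [add_sub_cancel_left, inner_smul_right] at this
  nlinarith

theorem regularSubdiff_maxFun (ha : Continuous a) (hb : Continuous b)
    (x : EuclideanSpace ℝ (Fin n)) :
    regularSubdiff (fun y => (maxFun a b y : EReal)) x =
      closure (convexHull ℝ (a '' activeSet a b x)) := by
  ext p
  constructor
  · rintro ⟨-, -, h⟩
    by_contra hp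
    obtain ⟨d, c, hc, hs⟩ := exists_direction_of_notMem ha hb hp
    -- With this tolerance the error `ε * ‖d‖` never exceeds the gap `⟨p, d⟩ - c`.
    have hε : 0 < (inner ℝ p d - c) / (‖d‖ + 1) := by
      have := norm_nonneg d
      have := sub_pos.2 hc
      positivity
    have hlim : Tendsto (fun s : ℝ => x + s • d) (𝓝[>] 0) (𝓝 x) := by
      have : Continuous fun s : ℝ => x + s • d := by fun_prop
      simpa using (this.tendsto 0).mono_left nhdsWithin_le_nhds
    obtain ⟨s, ⟨hs, hs0⟩, h'⟩ :=
      ((hs.and self_mem_nhdsWithin).and (hlim.eventually (h _ hε))).exists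
    have hs0 : 0 < s := hs0
    rw [← EReal.coe_add, EReal.coe_le_coe_iff, add_sub_cancel_left, inner_smul_right,
      norm_smul, Real.norm_of_nonneg hs0.le] at h'
    have h3 : (inner ℝ p d - c) / (‖d‖ + 1) * ‖d‖ ≤ inner ℝ p d - c := by
      rw [div_mul_eq_mul_div, div_le_iff₀ (by positivity)]
      nlinarith [norm_nonneg d]
    nlinarith [mul_le_mul_of_nonneg_left h3 hs0.le]
  · intro hp
    refine ⟨EReal.coe_ne_top _, EReal.coe_ne_bot _, fun ε hε => Eventually.of_forall fun y => ?_⟩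
    rw [← EReal.coe_add, EReal.coe_le_coe_iff]
    have := add_inner_le_maxFun ha hb hp y
    nlinarith [mul_nonneg hε.le (norm_nonneg (y - x))]

theorem subdiff_maxFun (ha : Continuous a) (hb : Continuous b)
    (x : EuclideanSpace ℝ (Fin n)) :
    subdiff (fun y => (maxFun a b y : EReal)) x = closure (convexHull ℝ (a '' activeSet a b x)) := by
  ext p
  constructor
  · rintro ⟨-, -, u, q, hu, -, hq, hqp⟩
    refine (mem_closure_convexHull_active_iff ha hb).2 fun y => ?_
    have hl : Tendsto (fun k => maxFun a b (u k) + inner ℝ (q k) (y - u k)) atTop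
        (𝓝 (maxFun a b x + inner ℝ p (y - x))) :=
      (((continuous_maxFun ha hb).tendsto x).comp hu).add (hqp.inner (tendsto_const_nhds.sub hu))
    refine le_of_tendsto' hl fun k => ?_
    have := hq k
    rw [regularSubdiff_maxFun ha hb] at this
    exact add_inner_le_maxFun ha hb this y
  · intro hp
    refine ⟨EReal.coe_ne_top _, EReal.coe_ne_bot _, fun _ => x, fun _ => p, tendsto_const_nhds,
      tendsto_const_nhds, fun _ => ?_, tendsto_const_nhds⟩
    rwa [regularSubdiff_maxFun ha hb]

theorem mem_outerSubdiff_maxFun_iff (ha : Continuous a) (hb : Continuous b)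
    {x v : EuclideanSpace ℝ (Fin n)} :
    v ∈ outerSubdiff (fun y => (maxFun a b y : EReal)) x ↔
      ∃ u p : ℕ → EuclideanSpace ℝ (Fin n), Tendsto u atTop (𝓝 x) ∧
        (∀ k, maxFun a b x < maxFun a b (u k)) ∧
        (∀ k, p k ∈ closure (convexHull ℝ (a '' activeSet a b (u k)))) ∧ Tendsto p atTop (𝓝 v) := by
  constructor
  · rintro ⟨-, -, u, p, hu, -, hlt, hp, hpv⟩
    exact ⟨u, p, hu, fun k => EReal.coe_lt_coe_iff.1 (hlt k),
      fun k => subdiff_maxFun ha hb (u k) ▸ hp k, hpv⟩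
  · rintro ⟨u, p, hu, hlt, hp, hpv⟩
    refine ⟨EReal.coe_ne_top _, EReal.coe_ne_bot _, u, p, hu, ?_,
      fun k => EReal.coe_lt_coe_iff.2 (hlt k), fun k => (subdiff_maxFun ha hb (u k)).symm ▸ hp k,
      hpv⟩
    exact (continuous_coe_real_ereal.comp (continuous_maxFun ha hb)).continuousAt.tendsto.comp hu

end MaxFun

end ErrBound

namespace ErrBound

/-! ### The error bound modulus of a maximum function -/

section ErrorBound

variable {n : ℕ} {T : Type*} [TopologicalSpace T] [CompactSpace T] [Nonempty T]
  {a : T → EuclideanSpace ℝ (Fin n)} {b : T → ℝ}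

/-- The constant `τ` is a local error bound constant at `x`. -/
def HasErrBound {n : ℕ} {T : Type*} (a : T → EuclideanSpace ℝ (Fin n)) (b : T → ℝ)
    (x : EuclideanSpace ℝ (Fin n)) (τ : ℝ) : Prop :=
  ∀ᶠ y in 𝓝 x, τ * Metric.infDist y (solSet a b) ≤ max (maxFun a b y) 0

/-- Nonemptiness keeps the extended distance finite, so it may be replaced by the real one. -/
theorem errBoundModulus_maxFun {n : ℕ} {T : Type*} {a : T → EuclideanSpace ℝ (Fin n)} {b : T → ℝ}
    (hne : (solSet a b).Nonempty) (x : EuclideanSpace ℝ (Fin n)) :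
    errBoundModulus (fun y => (maxFun a b y : EReal)) x =
      ⨆ (τ : ℝ≥0) (_ : 0 < τ ∧ HasErrBound a b x τ), (τ : ℝ≥0∞) := by
  have hS : {z | (maxFun a b z : EReal) ≤ 0} = solSet a b := by
    ext z
    exact EReal.coe_nonpos
  have key : ∀ (τ : ℝ≥0) (y : EuclideanSpace ℝ (Fin n)),
      (τ : ℝ≥0∞) * Metric.infEDist y {z | (maxFun a b z : EReal) ≤ 0} ≤
        (maxFun a b y : EReal).toENNReal ↔
      τ * Metric.infDist y (solSet a b) ≤ max (maxFun a b y) 0 := by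
    intro τ y
    rw [hS, EReal.real_coe_toENNReal, ← ENNReal.ofReal_toReal (Metric.infEDist_ne_top hne),
      ← ENNReal.ofReal_coe_nnreal, ← ENNReal.ofReal_mul τ.coe_nonneg,
      ← ENNReal.ofReal_le_ofReal_iff (le_max_right _ _), ENNReal.ofReal_max]
    simp [Metric.infDist]
  unfold errBoundModulus HasErrBound
  simp_rw [key]

/-- If a positive multiple of the distance to the solution set exceeds the residual at `y`, then
there is a small subgradient at a point outside the solution set no farther from `y`. -/
theorem exists_small_subgradient (ha : Continuous a) (hb : Continuous b)
    {y : EuclideanSpace ℝ (Fin n)} {τ : ℝ} (hτ : 0 < τ)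
    (hy : max (maxFun a b y) 0 < τ * Metric.infDist y (solSet a b)) :
    ∃ z p : EuclideanSpace ℝ (Fin n), dist z y ≤ Metric.infDist y (solSet a b) ∧
      0 < maxFun a b z ∧ p ∈ closure (convexHull ℝ (a '' activeSet a b z)) ∧ ‖p‖ ≤ τ := by
  set R := Metric.infDist y (solSet a b) with hR
  have hφ := continuous_maxFun ha hb
  -- The penalised residual at `y` is below `τ * R`, which forces its minimiser `z` strictly inside
  -- the ball, hence outside the solution set.
  obtain ⟨z, hzR, hz⟩ := (isCompact_closedBall y R).exists_isMinOn
    ⟨y, Metric.mem_closedBall_self Metric.infDist_nonneg⟩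
    (f := fun z => max (maxFun a b z) 0 + τ * ‖z - y‖) (by fun_prop)
  have hzy : max (maxFun a b z) 0 + τ * ‖z - y‖ < τ * R := by
    have : max (maxFun a b z) 0 + τ * ‖z - y‖ ≤ max (maxFun a b y) 0 + τ * ‖y - y‖ :=
      hz (Metric.mem_closedBall_self Metric.infDist_nonneg)
    rw [sub_self, norm_zero, mul_zero, add_zero] at this
    exact this.trans_lt hy
  have hzR' : dist z y < R := by
    rw [dist_eq_norm]
    nlinarith [le_max_right (maxFun a b z) 0]
  have hz0 : 0 < maxFun a b z := by
    by_contra h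
    have : R ≤ dist y z := Metric.infDist_le_dist_of_mem (show z ∈ solSet a b from not_lt.1 h)
    rw [dist_comm] at this
    linarith
  -- Otherwise separating the subdifferential from the ball of radius `τ` gives a descent direction
  -- steeper than the penalty can offset.
  by_contra! hno
  have hdisj : Disjoint (closure (convexHull ℝ (a '' activeSet a b z)))
      (Metric.closedBall 0 τ) := by
    refine Set.disjoint_left.2 fun p hp hp' => ?_
    exact (hno z p hzR'.le hz0 hp).not_ge (mem_closedBall_zero_iff.1 hp')
  obtain ⟨f, c, c', h1, hcc, h2⟩ := geometric_hahn_banach_closed_compact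
    (convex_convexHull ℝ _).closure isClosed_closure (convex_closedBall _ _)
    (isCompact_closedBall _ _) hdisj
  set d := (InnerProductSpace.toDual ℝ _).symm f with hd
  have hf : ∀ q, inner ℝ q d = f q := fun q => by
    rw [real_inner_comm, InnerProductSpace.toDual_symm_apply]
  have hc : c + τ * ‖d‖ < 0 := by
    -- The point of the ball where `f` is least, with value `-τ * ‖d‖`; for `d = 0` it is `0`.
    have hmem : -(τ / ‖d‖) • d ∈ Metric.closedBall (0 : EuclideanSpace ℝ (Fin n)) τ := by
      rw [mem_closedBall_zero_iff, norm_smul, norm_neg, Real.norm_of_nonneg (by positivity)]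
      rcases eq_or_ne ‖d‖ 0 with h0 | h0
      · simpa [h0] using hτ.le
      · exact (div_mul_cancel₀ _ h0).le
    have h3 := h2 _ hmem
    rw [← hf, real_inner_smul_left, real_inner_self_eq_norm_sq] at h3
    have h4 : τ / ‖d‖ * ‖d‖ ^ 2 = τ * ‖d‖ := by
      rcases eq_or_ne ‖d‖ 0 with h0 | h0
      · simp [h0]
      · field_simp
    nlinarith
  have hdir := eventually_maxFun_add_smul_lt ha hb (x := z) (d := d) (c := c) fun t ht => by
    rw [hf]
    exact h1 _ (subset_closure <| subset_convexHull ℝ _ ⟨t, ht, rfl⟩)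
  have hlim : Tendsto (fun s : ℝ => z + s • d) (𝓝[>] 0) (𝓝 z) := by
    have : Continuous fun s : ℝ => z + s • d := by fun_prop
    simpa using (this.tendsto 0).mono_left nhdsWithin_le_nhds
  obtain ⟨s, ⟨⟨hs, hs0⟩, hsb⟩, hspos⟩ := (((hdir.and self_mem_nhdsWithin).and
    (hlim.eventually (Metric.isOpen_ball.mem_nhds hzR'))).and
    (hlim.eventually (hφ.continuousAt.eventually (lt_mem_nhds hz0)))).exists
  have hs0 : 0 < s := hs0
  have hmin : max (maxFun a b z) 0 + τ * ‖z - y‖ ≤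
      max (maxFun a b (z + s • d)) 0 + τ * ‖z + s • d - y‖ := hz (Metric.ball_subset_closedBall hsb)
  rw [max_eq_left hz0.le, max_eq_left hspos.le] at hmin
  have htri : ‖z + s • d - y‖ ≤ ‖z - y‖ + s * ‖d‖ := by
    calc ‖z + s • d - y‖ = ‖(z - y) + s • d‖ := by congr 1; abel
      _ ≤ ‖z - y‖ + ‖s • d‖ := norm_add_le _ _
      _ = ‖z - y‖ + s * ‖d‖ := by rw [norm_smul, Real.norm_of_nonneg hs0.le]
  nlinarith [mul_le_mul_of_nonneg_left htri hτ.le]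

theorem infEDist_outerSubdiff_maxFun (ha : Continuous a) (hb : Continuous b)
    {x : EuclideanSpace ℝ (Fin n)} (hx : maxFun a b x = 0) :
    Metric.infEDist 0 (outerSubdiff (fun y => (maxFun a b y : EReal)) x) =
      errBoundModulus (fun y => (maxFun a b y : EReal)) x := by
  have hxS : x ∈ solSet a b := hx.le
  rw [errBoundModulus_maxFun ⟨x, hxS⟩]
  apply le_antisymm
  · by_contra! hlt
    obtain ⟨τ, hτ1, hτ2⟩ := ENNReal.lt_iff_exists_nnreal_btwn.1 hlt
    have hτ : 0 < τ := by
      have := (zero_le (a := (_ : ℝ≥0∞))).trans_lt hτ1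
      exact_mod_cast this
    by_cases hE : HasErrBound a b x τ
    · exact hτ1.not_ge (le_iSup₂ (f := fun (τ : ℝ≥0) (_ : 0 < τ ∧ HasErrBound a b x τ) =>
        (τ : ℝ≥0∞)) τ ⟨hτ, hE⟩)
    have hfreq : ∃ᶠ y in 𝓝 x, max (maxFun a b y) 0 < τ * Metric.infDist y (solSet a b) := by
      simpa only [HasErrBound, not_eventually, not_le] using hE
    -- The factor 2 arises from `dist z y ≤ d(y, S) ≤ dist y x`.
    have hex : ∀ k : ℕ, ∃ z p : EuclideanSpace ℝ (Fin n), dist z x ≤ 2 * (1 / ((k : ℝ) + 1)) ∧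
        0 < maxFun a b z ∧ p ∈ closure (convexHull ℝ (a '' activeSet a b z)) ∧ ‖p‖ ≤ τ := by
      intro k
      obtain ⟨y, hy, hyx⟩ := (hfreq.and_eventually
        (Metric.ball_mem_nhds x (Nat.one_div_pos_of_nat (α := ℝ) (n := k)))).exists
      obtain ⟨z, p, hz, hp⟩ := exists_small_subgradient ha hb (NNReal.coe_pos.2 hτ) hy
      refine ⟨z, p, ?_, hp⟩
      have h1 := Metric.infDist_le_dist_of_mem (x := y) hxS
      have h2 : dist y x < 1 / ((k : ℝ) + 1) := hyx
      linarith [dist_triangle z y x]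
    choose z p hz hpos hp hpτ using hex
    obtain ⟨v, hv, ψ, hψ, hlim⟩ := (isCompact_closedBall (0 : EuclideanSpace ℝ (Fin n))
      (τ : ℝ)).tendsto_subseq fun k => mem_closedBall_zero_iff.2 (hpτ k)
    have hzx : Tendsto z atTop (𝓝 x) := by
      refine tendsto_iff_dist_tendsto_zero.2 (squeeze_zero (fun _ => dist_nonneg) hz ?_)
      simpa using (tendsto_one_div_add_atTop_nhds_zero_nat (𝕜 := ℝ)).const_mul 2
    have hmem : v ∈ outerSubdiff (fun y => (maxFun a b y : EReal)) x :=
      (mem_outerSubdiff_maxFun_iff ha hb).2 ⟨z ∘ ψ, p ∘ ψ, hzx.comp hψ.tendsto_atTop,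
        fun k => hx ▸ hpos _, fun k => hp _, hlim⟩
    refine hτ2.not_ge ((Metric.infEDist_le_edist_of_mem hmem).trans ?_)
    rw [edist_comm, edist_zero_right, enorm_le_coe]
    exact mem_closedBall_zero_iff.1 hv
  · refine iSup₂_le fun τ hτ => Metric.le_infEDist.2 fun v hv => ?_
    obtain ⟨hτ0, hE⟩ := hτ
    obtain ⟨u, p, hu, hpos, hp, hpv⟩ := (mem_outerSubdiff_maxFun_iff ha hb).1 hv
    rw [edist_comm, edist_zero_right, coe_le_enorm, ← NNReal.coe_le_coe, coe_nnnorm]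
    refine ge_of_tendsto hpv.norm ?_
    filter_upwards [hu.eventually hE] with k hk
    have hpos' : 0 < maxFun a b (u k) := hx ▸ hpos k
    rw [max_eq_left hpos'.le] at hk
    -- The subgradient inequality at the projection `q` gives `φ (u k) ≤ ‖p k‖ * d(u k, S)`.
    obtain ⟨q, hq, hdq⟩ := (isClosed_solSet ha hb).exists_infDist_eq_dist ⟨x, hxS⟩ (u k)
    have hq0 : maxFun a b q ≤ 0 := hq
    have h1 := add_inner_le_maxFun ha hb (hp k) q
    have h2 : -(‖p k‖ * ‖q - u k‖) ≤ inner ℝ (p k) (q - u k) :=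
      neg_le_of_abs_le (abs_real_inner_le_norm _ _)
    rw [hdq, dist_comm, dist_eq_norm] at hk
    have h3 : 0 < ‖q - u k‖ := by
      refine norm_pos_iff.2 (sub_ne_zero.2 ?_)
      rintro rfl
      linarith
    exact le_of_mul_le_mul_right (by linarith) h3

end ErrorBound

end ErrBound

namespace ErrBound

/-! ### Closed cones of feasible directions -/

section FeasibleDirections

variable {n : ℕ} {S : Set (EuclideanSpace ℝ (Fin n))} {x y v w : EuclideanSpace ℝ (Fin n)}

/-- The cone of feasible directions of `S` at `x`. -/
def feasibleCone {n : ℕ} (S : Set (EuclideanSpace ℝ (Fin n))) (x : EuclideanSpace ℝ (Fin n)) :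
    Set (EuclideanSpace ℝ (Fin n)) :=
  {v | ∃ r : ℝ, 0 < r ∧ x + r • v ∈ S}

theorem posHull_image_sub (hx : x ∈ S) : posHull ((fun y => y - x) '' S) = feasibleCone S x := by
  ext v
  constructor
  · rintro (h | ⟨c, hc, _, ⟨y, hy, rfl⟩, rfl⟩)
    · obtain rfl : v = 0 := h
      exact ⟨1, one_pos, by simpa using hx⟩
    · refine ⟨c⁻¹, inv_pos.2 hc, ?_⟩
      rwa [inv_smul_smul₀ hc.ne', add_sub_cancel]
  · rintro ⟨r, hr, h⟩
    refine Or.inr ⟨r⁻¹, inv_pos.2 hr, _, ⟨_, h, rfl⟩, ?_⟩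
    simp only [add_sub_cancel_left]
    rw [inv_smul_smul₀ hr.ne']

theorem add_smul_mem_of_le (hS : Convex ℝ S) (hx : x ∈ S) {r s : ℝ} (hr : 0 < r)
    (h : x + r • v ∈ S) (hs : 0 ≤ s) (hsr : s ≤ r) : x + s • v ∈ S := by
  have := hS.add_smul_mem hx h (t := s / r) ⟨by positivity, div_le_one_of_le₀ hsr hr.le⟩
  rwa [smul_smul, div_mul_cancel₀ _ hr.ne'] at this

theorem smul_mem_feasibleCone (h : v ∈ feasibleCone S x) {c : ℝ} (hc : 0 < c) :
    c • v ∈ feasibleCone S x := by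
  obtain ⟨r, hr, h⟩ := h
  refine ⟨r / c, by positivity, ?_⟩
  rwa [smul_smul, div_mul_cancel₀ _ hc.ne']

theorem add_mem_feasibleCone (hS : Convex ℝ S) (hx : x ∈ S) (hv : v ∈ feasibleCone S x)
    (hw : w ∈ feasibleCone S x) : v + w ∈ feasibleCone S x := by
  obtain ⟨r, hr, hv⟩ := hv
  obtain ⟨s, hs, hw⟩ := hw
  refine ⟨min r s / 2, by positivity, ?_⟩
  have h1 := add_smul_mem_of_le hS hx hr hv (lt_min hr hs).le (min_le_left _ _)
  have h2 := add_smul_mem_of_le hS hx hs hw (lt_min hr hs).le (min_le_right _ _)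
  convert hS h1 h2 (by norm_num : (0 : ℝ) ≤ 1 / 2) (by norm_num : (0 : ℝ) ≤ 1 / 2)
    (by norm_num) using 1
  module

theorem zero_mem_feasibleCone (hx : x ∈ S) : (0 : EuclideanSpace ℝ (Fin n)) ∈ feasibleCone S x :=
  ⟨1, one_pos, by simpa using hx⟩

theorem feasibleCone_eq_univ_of_mem_interior (hx : x ∈ interior S) :
    feasibleCone S x = Set.univ := by
  refine Set.eq_univ_of_forall fun v => ?_
  have hlim : Tendsto (fun s : ℝ => x + s • v) (𝓝[>] 0) (𝓝 x) := by
    have : Continuous fun s : ℝ => x + s • v := by fun_prop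
    simpa using (this.tendsto 0).mono_left nhdsWithin_le_nhds
  obtain ⟨s, hs, hs0⟩ := ((hlim.eventually (mem_interior_iff_mem_nhds.1 hx)).and
    self_mem_nhdsWithin).exists
  exact ⟨s, hs0, hs⟩

/-- The lineality space of the cone of feasible directions. -/
def linealitySpace (hS : Convex ℝ S) (hx : x ∈ S) : Submodule ℝ (EuclideanSpace ℝ (Fin n)) where
  carrier := {v | v ∈ feasibleCone S x ∧ -v ∈ feasibleCone S x}
  zero_mem' := by simpa using zero_mem_feasibleCone hx
  add_mem' := fun hv hw => ⟨add_mem_feasibleCone hS hx hv.1 hw.1, by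
    rw [neg_add]
    exact add_mem_feasibleCone hS hx hv.2 hw.2⟩
  smul_mem' := fun c v hv => by
    rcases lt_trichotomy c 0 with hc | rfl | hc
    · refine ⟨?_, ?_⟩
      · have := smul_mem_feasibleCone hv.2 (neg_pos.2 hc)
        rwa [smul_neg, neg_smul, neg_neg] at this
      · have := smul_mem_feasibleCone hv.1 (neg_pos.2 hc)
        rwa [neg_smul] at this
    · simpa using zero_mem_feasibleCone hx
    · refine ⟨smul_mem_feasibleCone hv.1 hc, ?_⟩
      rw [← smul_neg]
      exact smul_mem_feasibleCone hv.2 hc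

/-- A convex set contains a relative neighbourhood in each subspace of feasible directions. -/
theorem exists_forall_mem_submodule (hS : Convex ℝ S) (hx : x ∈ S)
    {L : Submodule ℝ (EuclideanSpace ℝ (Fin n))} (hL : ∀ v ∈ L, v ∈ feasibleCone S x) :
    ∃ ε > 0, ∀ v ∈ L, ‖v‖ ≤ ε → x + v ∈ S := by
  let e := stdOrthonormalBasis ℝ L
  set N := Module.finrank ℝ L with hN
  rcases Nat.eq_zero_or_pos N with h0 | hpos
  · refine ⟨1, one_pos, fun v hv _ => ?_⟩
    have := (Submodule.finrank_eq_zero.1 (hN ▸ h0 : Module.finrank ℝ L = 0)) ▸ hv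
    rw [(Submodule.mem_bot ℝ).1 this, add_zero]
    exact hx
  have hbound : ∀ i, ∃ r > 0, ∀ c : ℝ, |c| ≤ r → x + c • (e i : EuclideanSpace ℝ (Fin n)) ∈ S := by
    intro i
    obtain ⟨r, hr, h1⟩ := hL _ (e i).2
    obtain ⟨s, hs, h2⟩ := hL _ (-(e i)).2
    refine ⟨min r s, lt_min hr hs, fun c hc => ?_⟩
    rcases le_total 0 c with h | h
    · rw [abs_of_nonneg h] at hc
      exact add_smul_mem_of_le hS hx hr h1 h (hc.trans (min_le_left _ _))
    · rw [abs_of_nonpos h] at hc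
      have := add_smul_mem_of_le hS hx hs h2 (neg_nonneg.2 h) (hc.trans (min_le_right _ _))
      simpa using this
  choose r hr hrS using hbound
  have hN' : (0 : ℝ) < N := by exact_mod_cast hpos
  have : Nonempty (Fin N) := ⟨⟨0, hpos⟩⟩
  obtain ⟨i₀, hi₀⟩ := Finite.exists_min r
  -- `x + v` is the average of the `N` points `x + N * c i • e i`, each on a segment known to lie in
  -- `S`.
  refine ⟨r i₀ / N, div_pos (hr _) hN', fun v hv hvn => ?_⟩
  set c : Fin N → ℝ := fun i => e.repr ⟨v, hv⟩ i with hc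
  have hsum : v = ∑ i, c i • (e i : EuclideanSpace ℝ (Fin n)) := by
    have := congrArg (Subtype.val) (e.sum_repr ⟨v, hv⟩)
    simpa using this.symm
  have hci : ∀ i, |c i| ≤ ‖v‖ := fun i => by
    have := PiLp.norm_apply_le (e.repr ⟨v, hv⟩) i
    rwa [e.repr.norm_map] at this
  have := hS.sum_mem (t := Finset.univ) (w := fun _ : Fin N => (1 / N : ℝ))
    (z := fun i => x + (N * c i) • (e i : EuclideanSpace ℝ (Fin n))) (fun _ _ => by positivity)
    (by simp [hN'.ne']) (fun i _ => hrS i _ (by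
      rw [abs_mul, abs_of_pos hN']
      have h1 := (hci i).trans hvn
      rw [le_div_iff₀ hN'] at h1
      linarith [hi₀ i]))
  convert this using 1
  simp only [smul_add, Finset.sum_add_distrib, smul_smul]
  congr 1
  · rw [← Finset.sum_smul]
    simp [hN'.ne']
  · rw [hsum]
    refine Finset.sum_congr rfl fun i _ => ?_
    congr 1
    field_simp

/-- Moving from `x` along a feasible direction enlarges the cone of feasible directions. -/
theorem feasibleCone_subset_of_segment (hS : Convex ℝ S) {r : ℝ} (h : x + r • w ∈ S) :
    feasibleCone S x ⊆ feasibleCone S (x + (r / 2) • w) := by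
  rintro v ⟨s, hs, hv⟩
  refine ⟨s / 2, by positivity, ?_⟩
  convert hS h hv (by norm_num : (0 : ℝ) ≤ 1 / 2) (by norm_num : (0 : ℝ) ≤ 1 / 2)
    (by norm_num) using 1
  module

/-- A convex set all of whose cones of feasible directions are closed agrees, locally at each of
its points, with the translated cone of feasible directions. -/
theorem exists_forall_mem_of_isClosed_feasibleCone (hS : Convex ℝ S)
    (hcl : ∀ y ∈ S, IsClosed (feasibleCone S y)) (hx : x ∈ S) :
    ∃ ε > 0, ∀ v ∈ feasibleCone S x, ‖v‖ ≤ ε → x + v ∈ S := by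
  -- The induction is on the codimension of the lineality space: moving along a feasible `w`
  -- orthogonal to it makes both `w` and `-w` feasible, so the space grows.
  induction hk : n - Module.finrank ℝ (linealitySpace hS hx) using Nat.strong_induction_on
    generalizing x with
  | _ k ih =>
  set L := linealitySpace hS hx with hLdef
  obtain ⟨ε₁, hε₁, h₁⟩ := exists_forall_mem_submodule hS hx (L := L) fun v hv => hv.1
  -- Closedness of the cone gives compactness of its unit directions orthogonal to `L`, hence a step
  -- length common to all of them.
  have hQ : IsCompact (Metric.sphere (0 : EuclideanSpace ℝ (Fin n)) 1 ∩
      (feasibleCone S x ∩ (Lᗮ : Set (EuclideanSpace ℝ (Fin n))))) :=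
    (isCompact_sphere _ _).inter_right ((hcl x hx).inter (Submodule.isClosed_orthogonal L))
  have hloc := hQ.eventually_forall_of_forall_eventually (x₀ := (0 : ℝ))
    (P := fun s w => w ∈ feasibleCone S x → 0 ≤ s → x + s • w ∈ S) (by
      rintro w ⟨hw1, ⟨r, hr, hrw⟩, hwL⟩
      have hy : x + (r / 2) • w ∈ S :=
        add_smul_mem_of_le hS hx hr hrw (by positivity) (by linarith)
      have hsub := feasibleCone_subset_of_segment hS hrw
      have hw2 : -w ∈ feasibleCone S (x + (r / 2) • w) :=
        ⟨r / 2, by positivity, by rw [smul_neg, add_neg_cancel_right]; exact hx⟩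
      have hlt : L < linealitySpace hS hy := by
        refine lt_of_le_of_ne (fun v hv => ⟨hsub hv.1, hsub hv.2⟩) fun heq => ?_
        have hwL' : w ∈ L := heq ▸ (show w ∈ linealitySpace hS hy from ⟨hsub ⟨r, hr, hrw⟩, hw2⟩)
        have h0 := Submodule.inner_right_of_mem_orthogonal hwL' hwL
        rw [real_inner_self_eq_norm_sq, mem_sphere_zero_iff_norm.1 hw1] at h0
        norm_num at h0
      have hlt' := Submodule.finrank_lt_finrank_of_lt hlt
      have hle : Module.finrank ℝ (linealitySpace hS hy) ≤ n := by
        simpa using (linealitySpace hS hy).finrank_le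
      obtain ⟨δ, hδ, hδS⟩ := ih _ (by omega) hy rfl
      have hcont : Continuous fun z : ℝ × EuclideanSpace ℝ (Fin n) => ‖(r / 2) • (z.2 - w)‖ := by
        fun_prop
      have hcont' : Continuous fun z : ℝ × EuclideanSpace ℝ (Fin n) => z.1 := by fun_prop
      filter_upwards [hcont.continuousAt.eventually (gt_mem_nhds
          (show ‖(r / 2) • (w - w)‖ < δ by simpa using hδ)),
        hcont'.continuousAt.eventually (gt_mem_nhds
          (show (0 : ℝ) < r / 2 by positivity))]
        with z hz1 hz2 hz3 hz4
      -- This vector leads from `x + (r / 2) • w` to `x + (r / 2) • z.2`, so the induction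
      -- hypothesis puts the latter in `S`.
      have hmem : (r / 2) • (z.2 - w) ∈ feasibleCone S (x + (r / 2) • w) := by
        refine smul_mem_feasibleCone ?_ (by positivity)
        rw [sub_eq_add_neg]
        exact add_mem_feasibleCone hS hy (hsub hz3) hw2
      have h4 := hδS _ hmem hz1.le
      rw [add_assoc, ← smul_add, add_sub_cancel] at h4
      exact add_smul_mem_of_le hS hx (by positivity) h4 hz4 hz2.le)
  obtain ⟨ε₂, hε₂, h₂⟩ := Metric.eventually_nhds_iff.1 hloc
  -- `x + v` is the midpoint of `x + 2l` and `x + 2(v - l)`, whose displacements have norms at most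
  -- `2‖v‖` and `4‖v‖`; the latter must be strictly below `ε₂`.
  refine ⟨min (ε₁ / 2) (ε₂ / 5), by positivity, fun v hv hvn => ?_⟩
  have hvn1 := hvn.trans (min_le_left _ _)
  have hvn2 := hvn.trans (min_le_right _ _)
  set l := L.starProjection v with hl
  have hlL : l ∈ L := L.starProjection_apply_mem v
  have hmL : v - l ∈ Lᗮ := L.sub_starProjection_mem_orthogonal v
  have hln : ‖l‖ ≤ ‖v‖ := L.norm_starProjection_apply_le v
  have hm : v - l ∈ feasibleCone S x := by
    rw [sub_eq_add_neg]
    exact add_mem_feasibleCone hS hx hv hlL.2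
  have hmn : ‖v - l‖ ≤ 2 * ‖v‖ := by linarith [norm_sub_le v l]
  have hA : x + (2 : ℝ) • l ∈ S := by
    refine h₁ _ (L.smul_mem _ hlL) ?_
    rw [norm_smul, Real.norm_of_nonneg (by norm_num)]
    linarith
  have hB : x + (2 : ℝ) • (v - l) ∈ S := by
    rcases eq_or_ne (v - l) 0 with h0 | h0
    · rw [h0, smul_zero, add_zero]
      exact hx
    have hpos := norm_pos_iff.2 h0
    have hmem : ‖v - l‖⁻¹ • (v - l) ∈ feasibleCone S x := smul_mem_feasibleCone hm (by positivity)
    have h5 := h₂ (y := 2 * ‖v - l‖) (by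
      rw [Real.dist_eq, sub_zero, abs_of_pos (by positivity)]
      linarith) (‖v - l‖⁻¹ • (v - l)) ⟨by
        rw [mem_sphere_zero_iff_norm, norm_smul, norm_inv, norm_norm, inv_mul_cancel₀ hpos.ne'],
        hmem, Lᗮ.smul_mem _ hmL⟩ hmem (by positivity)
    rwa [smul_smul, mul_assoc, mul_inv_cancel₀ hpos.ne', mul_one] at h5
  convert hS hA hB (by norm_num : (0 : ℝ) ≤ 1 / 2) (by norm_num : (0 : ℝ) ≤ 1 / 2)
    (by norm_num) using 1
  module

end FeasibleDirections

end ErrBound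

namespace ErrBound

/-! ### Regularity versus local polyhedrality -/

section Polyhedral

variable {n : ℕ} {T : Type*} {a : T → EuclideanSpace ℝ (Fin n)} {b : T → ℝ}
  {x : EuclideanSpace ℝ (Fin n)}

theorem mem_polarCone_active_iff {w : EuclideanSpace ℝ (Fin n)} :
    w ∈ polarCone (posHull (convexHull ℝ (a '' activeSet a b x))) ↔
      ∀ t ∈ activeSet a b x, inner ℝ (a t) w ≤ 0 := by
  constructor
  · intro h t ht
    have := h (a t) (Or.inr ⟨1, one_pos, a t,
      subset_convexHull ℝ _ ⟨t, ht, rfl⟩, (one_smul ℝ _).symm⟩)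
    rwa [real_inner_comm]
  · intro h v hv
    have hc : convexHull ℝ (a '' activeSet a b x) ⊆ {p | inner ℝ p w ≤ 0} := by
      refine convexHull_min ?_ ?_
      · rintro _ ⟨t, ht, rfl⟩
        exact h t ht
      · intro p hp q hq r s hr hs _
        simp only [Set.mem_ofPred_eq, inner_add_left, real_inner_smul_left] at *
        nlinarith [mul_nonneg hr (neg_nonneg.2 hp), mul_nonneg hs (neg_nonneg.2 hq)]
    rcases hv with h0 | ⟨c, hc', p, hp, rfl⟩
    · obtain rfl : v = 0 := h0
      simp
    · have : inner ℝ p w ≤ 0 := hc hp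
      rw [inner_smul_right, real_inner_comm]
      nlinarith

theorem isClosed_polarCone (A : Set (EuclideanSpace ℝ (Fin n))) : IsClosed (polarCone A) := by
  have : polarCone A = ⋂ p ∈ A, {v | inner ℝ v p ≤ 0} := by
    ext
    simp [polarCone]
  rw [this]
  exact isClosed_biInter fun p _ => isClosed_le (by fun_prop) continuous_const

theorem locallyPolyhedralAt_iff (hx : x ∈ solSet a b) : LocallyPolyhedralAt a b x ↔
    polarCone (posHull (convexHull ℝ (a '' activeSet a b x))) = feasibleCone (solSet a b) x := by
  rw [LocallyPolyhedralAt, posHull_image_sub hx]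

theorem LocallyPolyhedralAt.isClosed_feasibleCone (hx : x ∈ solSet a b)
    (h : LocallyPolyhedralAt a b x) : IsClosed (feasibleCone (solSet a b) x) := by
  rw [locallyPolyhedralAt_iff hx] at h
  exact h ▸ isClosed_polarCone _

variable [TopologicalSpace T] [CompactSpace T] [Nonempty T]

theorem RegularAt.exists_pos (ha : Continuous a) (hb : Continuous b) (h : RegularAt a b x) :
    ∃ ε > 0, ∀ w, ‖w‖ < ε →
      (x + w ∈ solSet a b ↔ ∀ t ∈ activeSet a b x, inner ℝ (a t) w ≤ 0) := by
  obtain ⟨V, hV, hVeq⟩ := h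
  obtain ⟨ε, hε, hball⟩ := Metric.mem_nhds_iff.1 hV
  refine ⟨ε, hε, fun w hw => ?_⟩
  have hwV : x + w ∈ V := hball (by simpa [dist_eq_norm] using hw)
  have := Set.ext_iff.1 hVeq (x + w)
  simp only [Set.mem_inter_iff, hwV, and_true, Set.mem_ofPred_eq, add_right_inj,
    exists_eq_right'] at this
  rw [mem_solSet_iff a b ha hb, this]

theorem regularAt_of_exists_pos (ha : Continuous a) (hb : Continuous b)
    (h : ∃ ε > 0, ∀ w, ‖w‖ < ε →
      (x + w ∈ solSet a b ↔ ∀ t ∈ activeSet a b x, inner ℝ (a t) w ≤ 0)) : RegularAt a b x := by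
  obtain ⟨ε, hε, h⟩ := h
  refine ⟨Metric.ball x ε, Metric.ball_mem_nhds x hε, ?_⟩
  ext y
  refine and_congr_left fun hy => ?_
  have h1 := h (y - x) (by rwa [← dist_eq_norm])
  rw [add_sub_cancel, mem_solSet_iff a b ha hb] at h1
  refine h1.trans ⟨fun h2 => ⟨_, h2, (add_sub_cancel _ _).symm⟩, ?_⟩
  rintro ⟨w, hw, rfl⟩
  rwa [add_sub_cancel_left]

/-- Both sides are cones, so small vectors decide; convexity of the solution set allows steps to be
shortened. -/
theorem RegularAt.locallyPolyhedralAt (ha : Continuous a) (hb : Continuous b)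
    (hx : x ∈ solSet a b) (h : RegularAt a b x) : LocallyPolyhedralAt a b x := by
  rw [locallyPolyhedralAt_iff hx]
  obtain ⟨ε, hε, h⟩ := h.exists_pos ha hb
  have hsmall : ∀ w : EuclideanSpace ℝ (Fin n), ∀ᶠ s in 𝓝[>] (0 : ℝ), ‖s • w‖ < ε := fun w => by
    have : Continuous fun s : ℝ => ‖s • w‖ := by fun_prop
    exact nhdsWithin_le_nhds (this.continuousAt.eventually
      (gt_mem_nhds (show ‖(0 : ℝ) • w‖ < ε by simpa using hε)))
  ext w
  rw [mem_polarCone_active_iff]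
  constructor
  · intro hw
    obtain ⟨s, hs, hs0⟩ := ((hsmall w).and self_mem_nhdsWithin).exists
    have hs0 : 0 < s := hs0
    refine ⟨s, hs0, (h _ hs).2 fun t ht => ?_⟩
    rw [inner_smul_right]
    exact mul_nonpos_of_nonneg_of_nonpos hs0.le (hw t ht)
  · rintro ⟨r, hr, hw⟩ t ht
    obtain ⟨s, ⟨hs, hs0⟩, hsr⟩ := (((hsmall w).and self_mem_nhdsWithin).and
      (nhdsWithin_le_nhds (gt_mem_nhds hr))).exists
    have hs0 : 0 < s := hs0
    have := (h _ hs).1 (add_smul_mem_of_le (convex_solSet ha hb) hx hr hw hs0.le hsr.le) t ht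
    rw [inner_smul_right] at this
    exact nonpos_of_mul_nonpos_right this hs0

/-- Closedness is required at every solution because the induction for local conicity moves to other
points of the set. -/
theorem LocallyPolyhedralAt.regularAt (ha : Continuous a) (hb : Continuous b)
    (hcl : ∀ y ∈ solSet a b, IsClosed (feasibleCone (solSet a b) y))
    (hx : x ∈ solSet a b) (h : LocallyPolyhedralAt a b x) : RegularAt a b x := by
  rw [locallyPolyhedralAt_iff hx] at h
  obtain ⟨ε, hε, hS⟩ := exists_forall_mem_of_isClosed_feasibleCone (convex_solSet ha hb) hcl hx
  refine regularAt_of_exists_pos ha hb ⟨ε, hε, fun w hw => ?_⟩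
  rw [← mem_polarCone_active_iff, h]
  exact ⟨fun hw' => ⟨1, one_pos, by rwa [one_smul]⟩, fun hw' => hS w hw' hw.le⟩

theorem maxFun_eq_zero_of_mem_frontier (ha : Continuous a) (hb : Continuous b)
    (hx : x ∈ frontier (solSet a b)) : maxFun a b x = 0 :=
  frontier_le_subset_eq (continuous_maxFun ha hb) continuous_const hx

/-- Inactive constraints are strict at `x`, and finitely many of them stay satisfied on a common
neighbourhood. -/
theorem regularAt_of_finite (ha : Continuous a) (hb : Continuous b) [Finite T]
    (hx : maxFun a b x = 0) : RegularAt a b x := by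
  have hev : ∀ᶠ w in 𝓝 (0 : EuclideanSpace ℝ (Fin n)), ∀ t, t ∉ activeSet a b x →
      inner ℝ (a t) (x + w) ≤ b t := by
    refine eventually_all.2 fun t => ?_
    by_cases ht : t ∈ activeSet a b x
    · exact Eventually.of_forall fun _ h => absurd ht h
    · have h1 := lt_maxFun_of_notMem_activeSet ha hb ht
      have h2 : Continuous fun w : EuclideanSpace ℝ (Fin n) => inner ℝ (a t) (x + w) := by fun_prop
      filter_upwards [h2.continuousAt.eventually
        (gt_mem_nhds (show inner ℝ (a t) (x + 0) < b t by rw [add_zero]; linarith))] with w hw _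
      exact hw.le
  obtain ⟨ε, hε, h⟩ := Metric.eventually_nhds_iff.1 hev
  refine regularAt_of_exists_pos ha hb ⟨ε, hε, fun w hw => ?_⟩
  rw [mem_solSet_iff a b ha hb]
  have hact : ∀ t ∈ activeSet a b x, inner ℝ (a t) x = b t := fun t ht => by
    have : inner ℝ (a t) x - b t = maxFun a b x := ht
    linarith
  constructor
  · intro h' t ht
    have := h' t
    rw [inner_add_right, hact t ht] at this
    linarith
  · intro h' t
    by_cases ht : t ∈ activeSet a b x
    · rw [inner_add_right, hact t ht]
      linarith [h' t ht]
    · exact h (by simpa [dist_eq_norm] using hw) t ht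

end Polyhedral

/-! ### Comparison with the support function of the subdifferential -/

section Support

variable {n : ℕ} {T : Type*} [TopologicalSpace T] [CompactSpace T] [Nonempty T]
  {a : T → EuclideanSpace ℝ (Fin n)} {b : T → ℝ} {x : EuclideanSpace ℝ (Fin n)}

/-- The coefficients of the active constraints. -/
def activeCoeff {n : ℕ} {T : Type*} (a : T → EuclideanSpace ℝ (Fin n)) (b : T → ℝ)
    (x : EuclideanSpace ℝ (Fin n)) : activeSet a b x → EuclideanSpace ℝ (Fin n) :=
  fun t => a t

theorem continuous_activeCoeff {n : ℕ} {T : Type*} [TopologicalSpace T]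
    {a : T → EuclideanSpace ℝ (Fin n)} {b : T → ℝ} {x : EuclideanSpace ℝ (Fin n)}
    (ha : Continuous a) : Continuous (activeCoeff a b x) :=
  ha.comp continuous_subtype_val

theorem compactSpace_activeSet {n : ℕ} {T : Type*} [TopologicalSpace T] [CompactSpace T]
    {a : T → EuclideanSpace ℝ (Fin n)} {b : T → ℝ} {x : EuclideanSpace ℝ (Fin n)}
    (ha : Continuous a) (hb : Continuous b) :
    CompactSpace (activeSet a b x) :=
  isCompact_iff_compactSpace.1 (isClosed_activeSet ha hb x).isCompact

theorem nonempty_activeSet (ha : Continuous a) (hb : Continuous b) :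
    Nonempty (activeSet a b x) :=
  let ⟨t, ht⟩ := exists_mem_activeSet ha hb x
  ⟨⟨t, ht⟩⟩

/-- This makes all results on maximum functions applicable to the support function. -/
theorem supportFun_subdiff_maxFun (ha : Continuous a) (hb : Continuous b) :
    supportFun (subdiff (fun y => (maxFun a b y : EReal)) x) =
      fun w => (maxFun (activeCoeff a b x) 0 w : EReal) := by
  have := compactSpace_activeSet ha hb (x := x)
  have := nonempty_activeSet ha hb (x := x)
  have ha' : Continuous (activeCoeff a b x) := continuous_activeCoeff ha
  have hb' : Continuous (0 : activeSet a b x → ℝ) := continuous_const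
  rw [subdiff_maxFun ha hb]
  funext w
  apply le_antisymm
  · refine iSup₂_le fun p hp => EReal.coe_le_coe_iff.2 ?_
    have hc : Convex ℝ {p : EuclideanSpace ℝ (Fin n) |
        inner ℝ p w ≤ maxFun (activeCoeff a b x) 0 w} := by
      intro p hp q hq r s hr hs hrs
      simp only [Set.mem_ofPred_eq, inner_add_left, real_inner_smul_left] at *
      obtain rfl : s = 1 - r := by linarith
      nlinarith [mul_le_mul_of_nonneg_left hp hr, mul_le_mul_of_nonneg_left hq hs]
    refine closure_minimal (convexHull_min ?_ hc) (isClosed_le (by fun_prop) continuous_const) hp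
    rintro _ ⟨t, ht, rfl⟩
    have := le_maxFun ha' hb' w ⟨t, ht⟩
    simpa [activeCoeff] using this
  · obtain ⟨t, ht⟩ := exists_mem_activeSet ha' hb' w
    have ht : inner ℝ (a t) w - 0 = maxFun (activeCoeff a b x) 0 w := ht
    rw [← ht, sub_zero]
    exact le_iSup₂ (f := fun (p : EuclideanSpace ℝ (Fin n)) (_ : p ∈ closure (convexHull ℝ
      (a '' activeSet a b x))) => ((inner ℝ p w : ℝ) : EReal)) (a t)
      (subset_closure (subset_convexHull ℝ _ ⟨t, t.2, rfl⟩))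

theorem maxFun_activeCoeff_zero (ha : Continuous a) (hb : Continuous b) :
    maxFun (activeCoeff a b x) 0 0 = 0 := by
  have := nonempty_activeSet ha hb (x := x)
  simp [maxFun]

theorem maxFun_zero_smul {T : Type*} (a : T → EuclideanSpace ℝ (Fin n)) {s : ℝ} (hs : 0 ≤ s)
    (w : EuclideanSpace ℝ (Fin n)) : maxFun a 0 (s • w) = s * maxFun a 0 w := by
  simp [maxFun, inner_smul_right, Real.mul_iSup_of_nonneg hs]

/-- Scaling a point of positive value `m` by `m⁻¹` turns its active set into a face; conversely a
face direction `w` is shrunk towards `0`. One inclusion holds only up to closure, which does not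
affect the distance. -/
theorem infEDist_outerSubdiff_support (ha : Continuous a) (hb : Continuous b) :
    Metric.infEDist 0 (outerSubdiff (fun w => (maxFun (activeCoeff a b x) 0 w : EReal)) 0) =
      Metric.infEDist 0 (⋃ T' ∈ activeFaces a b x, convexHull ℝ (a '' T')) := by
  have := compactSpace_activeSet ha hb (x := x)
  have := nonempty_activeSet ha hb (x := x)
  have ha' : Continuous (activeCoeff a b x) := continuous_activeCoeff ha
  have hb' : Continuous (0 : activeSet a b x → ℝ) := continuous_const
  have hzero := maxFun_activeCoeff_zero ha hb (x := x)
  apply le_antisymm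
  · refine Metric.infEDist_anti ?_
    refine Set.iUnion₂_subset fun T' hT' p hp => ?_
    obtain ⟨hsub, w, hw1, hw2⟩ := hT'
    -- The empty face is admissible but contributes an empty hull.
    have hne : T'.Nonempty := by
      rw [← Set.image_nonempty (f := a), ← convexHull_nonempty_iff (𝕜 := ℝ)]
      exact ⟨p, hp⟩
    obtain ⟨t₀, ht₀⟩ := hne
    have hmax : maxFun (activeCoeff a b x) 0 w = 1 := by
      refine le_antisymm ((maxFun_le_iff ha' hb').2 fun t => ?_) ?_
      · by_cases ht : (t : T) ∈ T'
        · simpa [activeCoeff] using (hw1 t ht).le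
        · simpa [activeCoeff] using (hw2 t ⟨t.2, ht⟩).le
      · have := le_maxFun ha' hb' w ⟨t₀, hsub ht₀⟩
        simpa [activeCoeff, hw1 t₀ ht₀] using this
    have hs : ∀ k : ℕ, (0 : ℝ) < 1 / ((k : ℝ) + 1) := fun k => Nat.one_div_pos_of_nat
    refine (mem_outerSubdiff_maxFun_iff ha' hb').2 ⟨fun k => (1 / ((k : ℝ) + 1)) • w, fun _ => p,
      ?_, fun k => ?_, fun k => ?_, tendsto_const_nhds⟩
    · simpa using (tendsto_one_div_add_atTop_nhds_zero_nat (𝕜 := ℝ)).smul_const w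
    · rw [hzero, maxFun_zero_smul _ (hs k).le, hmax, mul_one]
      exact hs k
    · refine subset_closure (convexHull_mono ?_ hp)
      rintro _ ⟨t, ht, rfl⟩
      refine ⟨⟨t, hsub ht⟩, ?_, rfl⟩
      change inner ℝ (a t) ((1 / ((k : ℝ) + 1)) • w) - 0 = _
      rw [maxFun_zero_smul _ (hs k).le, hmax, inner_smul_right, hw1 t ht, sub_zero]
  · rw [← Metric.infEDist_closure]
    refine Metric.infEDist_anti fun v hv => ?_
    obtain ⟨u, p, -, hpos, hp, hpv⟩ := (mem_outerSubdiff_maxFun_iff ha' hb').1 hv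
    refine isClosed_closure.mem_of_tendsto hpv (Eventually.of_forall fun k => ?_)
    refine closure_mono ?_ (hp k)
    set m := maxFun (activeCoeff a b x) 0 (u k) with hm
    have hm0 : 0 < m := hzero ▸ hpos k
    refine Set.subset_iUnion₂_of_subset
      {t | t ∈ activeSet a b x ∧ inner ℝ (a t) (m⁻¹ • u k) = 1} ⟨fun t ht => ht.1, m⁻¹ • u k,
        fun t ht => ht.2, fun t ht => ?_⟩ (convexHull_mono ?_)
    · refine lt_of_le_of_ne ?_ fun h => ht.2 ⟨ht.1, h⟩
      have := le_maxFun ha' hb' (u k) ⟨t, ht.1⟩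
      rw [inner_smul_right, inv_mul_le_iff₀ hm0, mul_one]
      simpa [activeCoeff] using this
    · rintro _ ⟨t, ht, rfl⟩
      refine ⟨t, ⟨t.2, ?_⟩, rfl⟩
      have ht : inner ℝ (a t) (u k) - 0 = m := ht
      rw [inner_smul_right, ← sub_zero (inner ℝ (a t) (u k)), ht, inv_mul_cancel₀ hm0.ne']

/-- Points of `B` outside the `ε`-ball are farther from `y` than `x` is. -/
theorem infDist_le_infDist_of_inter_ball_subset {α : Type*} [PseudoMetricSpace α] {A B : Set α}
    {x y : α} {ε : ℝ} (hA : x ∈ A) (hB : x ∈ B) (h : ∀ z ∈ B, dist z x < ε → z ∈ A)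
    (hy : dist y x < ε / 2) : Metric.infDist y A ≤ Metric.infDist y B := by
  refine (Metric.le_infDist ⟨x, hB⟩).2 fun z hz => ?_
  by_cases hzx : dist z x < ε
  · exact Metric.infDist_le_dist_of_mem (h z hz hzx)
  · refine (Metric.infDist_le_dist_of_mem hA).trans ?_
    linarith [dist_triangle z y x, dist_comm y z]

theorem mem_solSet_activeCoeff_iff (ha : Continuous a) (hb : Continuous b)
    {w : EuclideanSpace ℝ (Fin n)} : w ∈ solSet (activeCoeff a b x) 0 ↔
      ∀ t ∈ activeSet a b x, inner ℝ (a t) w ≤ 0 := by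
  have := compactSpace_activeSet ha hb (x := x)
  have := nonempty_activeSet ha hb (x := x)
  rw [mem_solSet_iff _ _ (continuous_activeCoeff ha) continuous_zero]
  exact Subtype.forall

theorem RegularAt.eventually_infDist_eq (ha : Continuous a) (hb : Continuous b)
    (hx : x ∈ solSet a b) (h : RegularAt a b x) :
    ∀ᶠ w in 𝓝 (0 : EuclideanSpace ℝ (Fin n)), Metric.infDist (x + w) (solSet a b) =
      Metric.infDist w (solSet (activeCoeff a b x) 0) := by
  obtain ⟨ε, hε, h⟩ := h.exists_pos ha hb
  have himage : solSet a b = (x + ·) '' {w | x + w ∈ solSet a b} := by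
    ext y
    exact ⟨fun hy => ⟨y - x, by simpa using hy, add_sub_cancel _ _⟩,
      by rintro ⟨w, hw, rfl⟩; exact hw⟩
  have h0 : (0 : EuclideanSpace ℝ (Fin n)) ∈ solSet (activeCoeff a b x) 0 :=
    (maxFun_activeCoeff_zero ha hb).le
  have h0' : (0 : EuclideanSpace ℝ (Fin n)) ∈ {w | x + w ∈ solSet a b} := by simpa using hx
  filter_upwards [Metric.ball_mem_nhds 0 (half_pos hε)] with w hw
  have heq : Metric.infDist (x + w) (solSet a b) =
      Metric.infDist w {w | x + w ∈ solSet a b} := by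
    conv_lhs => rw [himage]
    exact Metric.infDist_image (isometry_add_left x)
  rw [heq]
  refine le_antisymm (infDist_le_infDist_of_inter_ball_subset h0' h0 (fun z hz hzε => ?_) hw)
    (infDist_le_infDist_of_inter_ball_subset h0 h0' (fun z hz hzε => ?_) hw)
  · exact (h z (by simpa using hzε)).2 ((mem_solSet_activeCoeff_iff ha hb).1 hz)
  · exact (mem_solSet_activeCoeff_iff ha hb).2 ((h z (by simpa using hzε)).1 hz)

open scoped Pointwise in
theorem infDist_smul_solSet_zero {T : Type*} (a : T → EuclideanSpace ℝ (Fin n)) {s : ℝ}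
    (hs : 0 < s) (w : EuclideanSpace ℝ (Fin n)) :
    Metric.infDist (s • w) (solSet a 0) = s * Metric.infDist w (solSet a 0) := by
  have hcone : s • solSet a 0 = solSet a 0 := by
    ext y
    rw [Set.mem_smul_set_iff_inv_smul_mem₀ hs.ne']
    change maxFun a 0 (s⁻¹ • y) ≤ 0 ↔ maxFun a 0 y ≤ 0
    rw [maxFun_zero_smul a (inv_nonneg.2 hs.le), inv_mul_le_iff₀ hs, mul_zero]
  conv_lhs => rw [← hcone]
  rw [infDist_smul₀ hs.ne', Real.norm_of_nonneg hs.le]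

/-- Near `x` both distances agree. As `φ(x) = 0`, `φ(x + w) ≥ σ(w)` gives one direction; for the
other, `σ` bounds the directional growth of `φ`, and homogeneity turns the bound for small steps
into one for every `w`. -/
theorem RegularAt.hasErrBound_iff (ha : Continuous a) (hb : Continuous b)
    (hx : maxFun a b x = 0) (h : RegularAt a b x) (τ : ℝ) :
    HasErrBound a b x τ ↔ HasErrBound (activeCoeff a b x) 0 0 τ := by
  have := compactSpace_activeSet ha hb (x := x)
  have := nonempty_activeSet ha hb (x := x)
  have ha' : Continuous (activeCoeff a b x) := continuous_activeCoeff ha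
  have hb' : Continuous (0 : activeSet a b x → ℝ) := continuous_const
  have hdist := h.eventually_infDist_eq ha hb hx.le
  constructor
  · intro hE
    refine Eventually.of_forall fun w => ?_
    by_contra! hlt
    -- The growth estimate needs a rate strictly above `σ(w)`.
    obtain ⟨c, hc1, hc2⟩ := exists_between hlt
    have hdir := eventually_maxFun_add_smul_lt ha hb (x := x) (d := w) (c := c) fun t ht => by
      have := le_maxFun ha' hb' w ⟨t, ht⟩
      simp only [activeCoeff, Pi.zero_apply, sub_zero] at this
      exact this.trans_lt ((le_max_left _ _).trans_lt hc1)
    have hlim : Tendsto (fun s : ℝ => s • w) (𝓝[>] 0) (𝓝 0) := by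
      have : Continuous fun s : ℝ => s • w := by fun_prop
      simpa using (this.tendsto 0).mono_left nhdsWithin_le_nhds
    have hlim' : Tendsto (fun s : ℝ => x + s • w) (𝓝[>] 0) (𝓝 x) := by
      simpa using hlim.const_add x
    obtain ⟨s, ⟨⟨hs, hs0⟩, hsd⟩, hsE⟩ := (((hdir.and self_mem_nhdsWithin).and
      (hlim.eventually hdist)).and (hlim'.eventually hE)).exists
    have hs0 : 0 < s := hs0
    rw [hsd, infDist_smul_solSet_zero _ hs0] at hsE
    have hc0 : 0 < c := (le_max_right _ _).trans_lt hc1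
    have h1 : max (maxFun a b (x + s • w)) 0 ≤ s * c :=
      max_le (by linarith) (by positivity)
    nlinarith [mul_lt_mul_of_pos_left hc2 hs0]
  · intro hE
    have hlim : Tendsto (fun y => y - x) (𝓝 x) (𝓝 0) := by
      have : Continuous fun y : EuclideanSpace ℝ (Fin n) => y - x := by fun_prop
      simpa using this.tendsto x
    filter_upwards [hlim.eventually hE, hlim.eventually hdist] with y hy hyd
    rw [add_sub_cancel] at hyd
    rw [hyd]
    refine hy.trans (max_le_max_right 0 ((maxFun_le_iff ha' hb').2 fun t => ?_))
    have h1 := le_maxFun ha hb y t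
    have h2 : inner ℝ (a t) x - b t = maxFun a b x := t.2
    simp only [activeCoeff, Pi.zero_apply, sub_zero, inner_sub_right]
    linarith

/-! ### Modulus formulas under regularity -/

theorem RegularAt.modulusFormulas (ha : Continuous a) (hb : Continuous b)
    (hx : maxFun a b x = 0) (h : RegularAt a b x) : ModulusFormulas a b x := by
  have := compactSpace_activeSet ha hb (x := x)
  have := nonempty_activeSet ha hb (x := x)
  have hzero := maxFun_activeCoeff_zero ha hb (x := x)
  refine ⟨infEDist_outerSubdiff_maxFun ha hb hx, ?_, ?_⟩
  · rw [supportFun_subdiff_maxFun ha hb, infEDist_outerSubdiff_maxFun (continuous_activeCoeff ha)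
      continuous_zero hzero, errBoundModulus_maxFun ⟨x, hx.le⟩,
      errBoundModulus_maxFun ⟨0, hzero.le⟩]
    simp_rw [h.hasErrBound_iff ha hb hx]
  · rw [supportFun_subdiff_maxFun ha hb, infEDist_outerSubdiff_support ha hb]

/-- If the maximum function is constant and negative, all moduli are infinite. -/
theorem modulusFormulas_of_forall_eq (ha : Continuous a) (hb : Continuous b)
    (hconst : ∀ y, maxFun a b y = maxFun a b x) (hneg : maxFun a b x < 0)
    (hact : ∀ t ∈ activeSet a b x, a t = 0) : ModulusFormulas a b x := by
  have := compactSpace_activeSet ha hb (x := x)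
  have := nonempty_activeSet ha hb (x := x)
  have hS : solSet a b = Set.univ := Set.eq_univ_of_forall fun y => (hconst y ▸ hneg.le :)
  have h1 : outerSubdiff (fun y => (maxFun a b y : EReal)) x = ∅ := by
    refine Set.eq_empty_of_forall_notMem fun v hv => ?_
    obtain ⟨u, -, -, hpos, -⟩ := (mem_outerSubdiff_maxFun_iff ha hb).1 hv
    exact (hpos 0).ne (hconst _).symm
  have h2 : outerSubdiff (fun w => (maxFun (activeCoeff a b x) 0 w : EReal)) 0 = ∅ := by
    refine Set.eq_empty_of_forall_notMem fun v hv => ?_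
    obtain ⟨u, -, -, hpos, -⟩ :=
      (mem_outerSubdiff_maxFun_iff (continuous_activeCoeff ha) continuous_zero).1 hv
    refine (hpos 0).ne ?_
    simp [maxFun, activeCoeff, hact]
  have h3 : errBoundModulus (fun y => (maxFun a b y : EReal)) x = ⊤ := by
    rw [errBoundModulus_maxFun ⟨x, hneg.le⟩]
    refine ENNReal.eq_top_of_forall_nnreal_le fun r => ?_
    -- Admissible constants must be positive, hence `r + 1`.
    refine le_trans (ENNReal.coe_le_coe.2 (le_add_of_nonneg_right zero_le_one))
      (le_iSup₂ (f := fun (τ : ℝ≥0) (_ : 0 < τ ∧ HasErrBound a b x τ) => (τ : ℝ≥0∞)) (r + 1)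
        ⟨by positivity, Eventually.of_forall fun y => ?_⟩)
    rw [hS, Metric.infDist_zero_of_mem (Set.mem_univ y), mul_zero]
    exact le_max_right _ _
  refine ⟨?_, ?_, ?_⟩
  · rw [h1, h3, Metric.infEDist_empty]
  · rw [supportFun_subdiff_maxFun ha hb, h2, h3, Metric.infEDist_empty]
  · rw [supportFun_subdiff_maxFun ha hb, infEDist_outerSubdiff_support ha hb]

/-- At a regular point of the interior of the sublevel set the active coefficients vanish. -/
theorem RegularAt.eq_zero_of_neg (ha : Continuous a) (hb : Continuous b)
    (hx : maxFun a b x < 0) (h : RegularAt a b x) : ∀ t ∈ activeSet a b x, a t = 0 := by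
  obtain ⟨ε, hε, h⟩ := h.exists_pos ha hb
  intro t ht
  -- A short step along `a t` itself stays in the solution set, so regularity yields `⟨a t, a t⟩ ≤
  -- 0`.
  have hc : Continuous fun s : ℝ => maxFun a b (x + s • a t) :=
    (continuous_maxFun ha hb).comp (by fun_prop)
  have hn : Continuous fun s : ℝ => ‖s • a t‖ := by fun_prop
  have h1 : ∀ᶠ s in 𝓝[>] (0 : ℝ), maxFun a b (x + s • a t) < 0 :=
    nhdsWithin_le_nhds (hc.continuousAt.eventually
      (gt_mem_nhds (show maxFun a b (x + (0 : ℝ) • a t) < 0 by simpa using hx)))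
  have h2 : ∀ᶠ s in 𝓝[>] (0 : ℝ), ‖s • a t‖ < ε :=
    nhdsWithin_le_nhds (hn.continuousAt.eventually
      (gt_mem_nhds (show ‖(0 : ℝ) • a t‖ < ε by simpa using hε)))
  obtain ⟨s, ⟨hs, hsε⟩, hs0⟩ := ((h1.and h2).and self_mem_nhdsWithin).exists
  have hs0 : 0 < s := hs0
  have := (h _ hsε).1 hs.le t ht
  rw [inner_smul_right] at this
  exact real_inner_self_nonpos.1 (nonpos_of_mul_nonpos_right this hs0)

theorem modulusFormulas_of_forall_regularAt (ha : Continuous a) (hb : Continuous b)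
    (h : ∀ y ∈ solSet a b, RegularAt a b y) (hx : x ∈ solSet a b) : ModulusFormulas a b x := by
  have hx' : maxFun a b x ≤ 0 := hx
  rcases hx'.eq_or_lt with h0 | hneg
  · exact (h x hx).modulusFormulas ha hb h0
  have hzero : ∀ y, maxFun a b y < 0 → ∀ t ∈ activeSet a b y, a t = 0 := fun y hy =>
    (h y hy.le).eq_zero_of_neg ha hb hy
  have hmin : ∀ y, maxFun a b y < 0 → ∀ z, maxFun a b y ≤ maxFun a b z := fun y hy z => by
    obtain ⟨t, ht⟩ := exists_mem_activeSet ha hb y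
    have h1 := le_maxFun ha hb z t
    have h2 : inner ℝ (a t) y - b t = maxFun a b y := ht
    rw [hzero y hy t ht, inner_zero_left] at *
    linarith
  -- Points with `φ < 0` are global minimisers, so this open set is also a closed sublevel set;
  -- connectedness makes it the whole space.
  have hclopen : IsClopen {y | maxFun a b y < 0} := by
    refine ⟨?_, isOpen_lt (continuous_maxFun ha hb) continuous_const⟩
    have : {y | maxFun a b y < 0} = {y | maxFun a b y ≤ maxFun a b x} := by
      ext y
      exact ⟨fun hy => hmin y hy x, fun hy => lt_of_le_of_lt hy hneg⟩
    rw [this]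
    exact isClosed_le (continuous_maxFun ha hb) continuous_const
  have huniv := hclopen.eq_univ ⟨x, hneg⟩
  refine modulusFormulas_of_forall_eq ha hb (fun y => ?_) hneg (hzero x hneg)
  have hy : y ∈ {y | maxFun a b y < 0} := huniv ▸ Set.mem_univ y
  exact le_antisymm (hmin y hy x) (hmin x hneg y)

theorem forall_regularAt_iff (ha : Continuous a) (hb : Continuous b) :
    (∀ x ∈ solSet a b, RegularAt a b x) ↔ ∀ x ∈ solSet a b, LocallyPolyhedralAt a b x :=
  ⟨fun h x hx => (h x hx).locallyPolyhedralAt ha hb hx, fun h x hx => (h x hx).regularAt ha hb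
    (fun y hy => (h y hy).isClosed_feasibleCone hy) hx⟩

/-- Interior points need no hypothesis: their feasible cone is the whole space, hence closed. -/
theorem forall_frontier_regularAt_iff (ha : Continuous a) (hb : Continuous b) :
    (∀ x ∈ frontier (solSet a b), RegularAt a b x) ↔
      ∀ x ∈ frontier (solSet a b), LocallyPolyhedralAt a b x := by
  have hcl := isClosed_solSet ha hb
  refine ⟨fun h x hx => (h x hx).locallyPolyhedralAt ha hb (hcl.frontier_subset hx),
    fun h x hx => (h x hx).regularAt ha hb (fun y hy => ?_) (hcl.frontier_subset hx)⟩
  by_cases hyi : y ∈ interior (solSet a b)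
  · rw [feasibleCone_eq_univ_of_mem_interior hyi]
    exact isClosed_univ
  · exact (h y ⟨subset_closure hy, hyi⟩).isClosed_feasibleCone hy

end Support

end ErrBound

end

/-! ### The main theorem -/

theorem mainTheorem8 {n : ℕ} {T : Type*} [TopologicalSpace T] [CompactSpace T] [Nonempty T]
    (a : T → EuclideanSpace ℝ (Fin n)) (b : T → ℝ) (ha : Continuous a) (hb : Continuous b) :
    -- all solutions
    (((∀ x ∈ ErrBound.solSet a b, ErrBound.RegularAt a b x) ↔
        ∀ x ∈ ErrBound.solSet a b, ErrBound.LocallyPolyhedralAt a b x) ∧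
      (((∀ x ∈ ErrBound.solSet a b, ErrBound.RegularAt a b x) ∨
          ∀ x ∈ ErrBound.solSet a b, ErrBound.LocallyPolyhedralAt a b x) →
        ∀ x ∈ ErrBound.solSet a b, ErrBound.ModulusFormulas a b x)) ∧
    -- all solutions on the boundary of the solution set
    (((∀ x ∈ frontier (ErrBound.solSet a b), ErrBound.RegularAt a b x) ↔
        ∀ x ∈ frontier (ErrBound.solSet a b), ErrBound.LocallyPolyhedralAt a b x) ∧
      (((∀ x ∈ frontier (ErrBound.solSet a b), ErrBound.RegularAt a b x) ∨
          ∀ x ∈ frontier (ErrBound.solSet a b), ErrBound.LocallyPolyhedralAt a b x) →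
        ∀ x ∈ frontier (ErrBound.solSet a b), ErrBound.ModulusFormulas a b x)) ∧
    -- finite systems
    (Finite T → ∀ x ∈ frontier (ErrBound.solSet a b),
      ErrBound.LocallyPolyhedralAt a b x ∧ ErrBound.ModulusFormulas a b x) := by
  have hfr : ∀ x ∈ frontier (ErrBound.solSet a b), ErrBound.RegularAt a b x →
      ErrBound.ModulusFormulas a b x := fun x hx h =>
    h.modulusFormulas ha hb (ErrBound.maxFun_eq_zero_of_mem_frontier ha hb hx)
  refine ⟨⟨ErrBound.forall_regularAt_iff ha hb, fun h x hx => ?_⟩,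
    ⟨ErrBound.forall_frontier_regularAt_iff ha hb, fun h x hx => ?_⟩, fun _ x hx => ?_⟩
  · exact ErrBound.modulusFormulas_of_forall_regularAt ha hb
      (h.elim id (ErrBound.forall_regularAt_iff ha hb).2) hx
  · exact hfr x hx (h.elim id (ErrBound.forall_frontier_regularAt_iff ha hb).2 x hx)
  · have hreg := ErrBound.regularAt_of_finite ha hb
      (ErrBound.maxFun_eq_zero_of_mem_frontier ha hb hx)
    exact ⟨hreg.locallyPolyhedralAt ha hb ((ErrBound.isClosed_solSet ha hb).frontier_subset hx),
      hfr x hx hreg⟩
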